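/- All graphs are finite and simple (the graph with no vertices is allowed). For a set $\mathcal F$ of graphs, let $\mathrm{Forb}(\mathcal F)$ be the class of all graphs $G$ such that no $F\in\mathcal F$ has a homomorphism to $G$. A class of graphs is minor closed if it contains every minor of each of its members (up to isomorphism), and proper if it is not the class of all graphs. The Hadwiger number $h(G)$ of a graph $G$ is the largest $n$ such that $K_n$ is a minor of $G$, and $h(\mathcal K)=\sup_{G\in\mathcal K}h(G)$ (with $\sup\emptyset=0$) for a class $\mathcal K$. Let $\mathcal K$ be a proper minor closed class of graphs. Then: 1. For every finite set $\mathcal F$ of connected graphs (a connected graph has at least one vertex) there exists a finite graph $U=U(\mathcal K,\mathcal F)\in\mathrm{Forb}(\mathcal F)$ such that every graph in $\mathcal K\cap\mathrm{Forb}(\mathcal F)$ has a homomorphism to $U$. 2. The Hadwiger number $h=h(\mathcal K)$ is finite, $K_{h+1}\notin\mathcal K$, and there exists a finite graph $U$ containing no $K_{h+1}$ such that every graph in $\mathcal K$ has a homomorphism to $U$. -/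

import Mathlib

universe u

/-- A finite simple graph (the graph with no vertices is allowed). -/
structure FinGraph where
  V : Type u
  [finite : Finite V]
  graph : SimpleGraph V

namespace FinGraph

/-- `G` maps homomorphically to `H`. -/
def HomTo (G H : FinGraph.{u}) : Prop := Nonempty (G.graph →g H.graph)

/-- The complete graph `K_n` on `n` vertices. -/
def complete (n : ℕ) : FinGraph.{u} where
  V := ULift.{u} (Fin n)
  graph := ⊤

/-- `Forb F`: the class of all finite graphs to which no member of `F` maps homomorphically. -/
def Forb (F : Set FinGraph.{u}) : Set FinGraph.{u} := {G | ∀ A ∈ F, ¬ A.HomTo G}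

/-- `H` is a minor of `G`: there are pairwise disjoint connected (in particular nonempty) branch
sets in `G`, one for each vertex of `H`, such that the branch sets of adjacent vertices of `H`
are joined by an edge of `G`.  Equivalently, a graph isomorphic to `H` arises from a subgraph
of `G` by contracting edges. -/
def IsMinor (H G : FinGraph.{u}) : Prop :=
  ∃ B : H.V → Set G.V,
    (∀ v, (G.graph.induce (B v)).Connected) ∧
    (∀ v w, v ≠ w → Disjoint (B v) (B w)) ∧
    (∀ v w, H.graph.Adj v w → ∃ x ∈ B v, ∃ y ∈ B w, G.graph.Adj x y)

/-- A class of finite graphs is minor closed if it contains all minors of its members.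
(It is then closed under isomorphism, an isomorphic copy of `G` being a minor of `G`.) -/
def IsMinorClosed (K : Set FinGraph.{u}) : Prop :=
  ∀ G ∈ K, ∀ H : FinGraph.{u}, H.IsMinor G → H ∈ K

/-- A minor closed class that is not the class of all finite graphs. -/
def IsProperMinorClosed (K : Set FinGraph.{u}) : Prop :=
  IsMinorClosed K ∧ K ≠ Set.univ

/-- The Hadwiger number of a graph: the largest `n` such that `K_n` is a minor of `G`. -/
noncomputable def hadwigerNumber (G : FinGraph.{u}) : ℕ∞ :=
  ⨆ (n : ℕ) (_ : (complete.{u} n).IsMinor G), (n : ℕ∞)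

/-- The Hadwiger number of a class: the supremum of the Hadwiger numbers of its members. -/
noncomputable def classHadwigerNumber (K : Set FinGraph.{u}) : ℕ∞ :=
  ⨆ G ∈ K, G.hadwigerNumber

end FinGraph

/-! The class excludes some `K_t` as a minor. Hence, for each p, boundedly many colours suffice for
every path with at most 2 ^ p vertices to have a uniquely coloured vertex
(`exists_coloring_of_not_hasCliqueMinor`). Splitting paths at such vertices shows that p colours
never induce a path with 2 ^ p vertices, and graphs without long paths fall into finitely many
homomorphic equivalence classes (`homFinite_of_path_length_le`).

Let p bound the orders of the forbidden graphs. A graph G of the class in Forb(F) selects, for each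
set I of at most p colours, a representative X_I of the subgraph induced by I, and maps to the
`colorProduct` of these. A forbidden graph mapping to the product would use at most p colours, hence
map to one X_I and so to G. U is the disjoint union of the products over the finitely many
admissible selections; connectedness confines a forbidden graph to one summand.

For the colouring, parts are removed one by one, each a union of t geodesics from a common root
(`IsDecomposition.extend`). The earlier parts attached to a remaining component are pairwise
adjacent, so there are fewer than t of them. A greedy colouring then separates nearby parts, and
positions on geodesics separate vertices within a part.

The Hadwiger statement is the case F = {K_(h+1)}. -/

/-- The disjoint union of a family of graphs. -/
def sigmaGraph {ι : Type*} {W : ι → Type*} (H : ∀ i, SimpleGraph (W i)) :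
    SimpleGraph (Σ i, W i) where
  Adj a b := ∃ h : a.1 = b.1, (H b.1).Adj (h ▸ a.2) b.2
  symm := ⟨by
    rintro ⟨i, x⟩ ⟨j, y⟩ ⟨h, hxy⟩
    dsimp at h
    subst h
    exact ⟨rfl, hxy.symm⟩⟩
  loopless := ⟨by
    rintro ⟨i, x⟩ ⟨_, hx⟩
    exact (H i).loopless.irrefl _ hx⟩

theorem sigmaGraph_adj_mk {ι : Type*} {W : ι → Type*} (H : ∀ i, SimpleGraph (W i)) {i : ι}
    {x y : W i} : (sigmaGraph H).Adj ⟨i, x⟩ ⟨i, y⟩ ↔ (H i).Adj x y :=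
  ⟨fun ⟨_, h⟩ => h, fun h => ⟨rfl, h⟩⟩

/-- A homomorphism from a connected graph to a disjoint union maps to a single summand. -/
theorem exists_hom_of_hom_sigmaGraph {V ι : Type*} {W : ι → Type*} {G : SimpleGraph V}
    (hG : G.Connected) (H : ∀ i, SimpleGraph (W i)) (f : G →g sigmaGraph H) :
    ∃ i, Nonempty (G →g H i) := by
  obtain ⟨v⟩ := hG.nonempty
  have key : ∀ w, (f w).1 = (f v).1 := by
    intro w
    obtain ⟨p⟩ := hG.preconnected w v
    induction p with
    | nil => rfl
    | cons h _ ih => exact (f.map_adj h).1.trans ih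
  have key' : ∀ w, ∃ x, f w = ⟨(f v).1, x⟩ := by
    have : ∀ (a : Σ i, W i) (j : ι), a.1 = j → ∃ x, a = ⟨j, x⟩ := by
      rintro ⟨i, x⟩ _ rfl
      exact ⟨x, rfl⟩
    exact fun w => this _ _ (key w)
  choose g hg using key'
  refine ⟨(f v).1, ⟨⟨g, fun {a b} hab => ?_⟩⟩⟩
  have := f.map_adj hab
  rw [hg a, hg b] at this
  exact (sigmaGraph_adj_mk H).1 this

/-! ### Labelled graphs without long paths, up to homomorphic equivalence -/

/-- A finite simple graph with a vertex labelling. -/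
structure LabeledGraph (L : Type) where
  V : Type u
  [finite : Finite V]
  graph : SimpleGraph V
  label : V → L

namespace LabeledGraph

variable {L : Type}

/-- There is a label preserving homomorphism from `X` to `Y`. -/
def HomTo (X Y : LabeledGraph.{u} L) : Prop :=
  ∃ f : X.graph →g Y.graph, ∀ v, Y.label (f v) = X.label v

/-- The labelled subgraph induced on a set of vertices. -/
def induce (X : LabeledGraph.{u} L) (s : Set X.V) : LabeledGraph.{u} L where
  V := s
  finite := haveI := X.finite; inferInstance
  graph := X.graph.induce s
  label v := X.label v

/-- Delete a vertex, and record its neighbours in the labels. -/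
def deleteVert (X : LabeledGraph.{u} L) (v : X.V) : LabeledGraph.{u} (L × Prop) where
  V := {w : X.V // w ≠ v}
  finite := haveI := X.finite; inferInstance
  graph := X.graph.induce {w | w ≠ v}
  label w := (X.label w, X.graph.Adj v w)

/-- The disjoint union of finitely many labelled graphs. -/
def sigma {ι : Type} [Finite ι] (X : ι → LabeledGraph.{u} L) : LabeledGraph.{u} L where
  V := Σ i, (X i).V
  finite := haveI := fun i => (X i).finite; inferInstance
  graph := sigmaGraph fun i => (X i).graph
  label v := (X v.1).label v.2

/-- Add a vertex labelled `a`, adjacent to the vertices whose label has a true second component. -/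
def cone (a : L) (X : LabeledGraph.{u} (L × Prop)) : LabeledGraph.{u} L where
  V := Option X.V
  finite := haveI := X.finite; inferInstance
  graph :=
    { Adj := fun x y => match x, y with
        | none, none => False
        | none, some y => (X.label y).2
        | some x, none => (X.label x).2
        | some x, some y => X.graph.Adj x y
      symm := ⟨by
        rintro (_ | x) (_ | y) h
        · exact h
        · exact h
        · exact h
        · exact X.graph.symm.symm _ _ h⟩
      loopless := ⟨by
        rintro (_ | x) h
        · exact h
        · exact X.graph.loopless.irrefl _ h⟩ }
  label x := match x with
    | none => a
    | some x => (X.label x).1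

/-- The members of the class are, up to homomorphic equivalence, finite in number. -/
def HomFinite (P : LabeledGraph.{u} L → Prop) : Prop :=
  ∃ (ι : Type) (_ : Finite ι) (X : ι → LabeledGraph.{u} L),
    ∀ Y, P Y → ∃ i, Y.HomTo (X i) ∧ (X i).HomTo Y

/-- Multiplicities do not matter: the graph is equivalent to the disjoint union of one copy of each
representative occurring among its components, so a subset of `ι` determines it. -/
theorem HomFinite.components {P : LabeledGraph.{u} L → Prop} (hP : HomFinite P) :
    HomFinite fun Y : LabeledGraph.{u} L =>
      ∀ c : Y.graph.ConnectedComponent, P (Y.induce c.supp) := by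
  obtain ⟨ι, _, X, hX⟩ := hP
  refine ⟨Set ι, inferInstance, fun S => sigma fun i : S => X i, fun Y hY => ?_⟩
  choose i hi hi' using fun c => hX _ (hY c)
  choose f hf using hi
  choose g hg using hi'
  refine ⟨Set.range i, ⟨⟨fun v => ⟨⟨i (Y.graph.connectedComponentMk v), _, rfl⟩,
    f _ ⟨v, rfl⟩⟩, ?_⟩, fun v => hf _ _⟩, ?_⟩
  · intro v w hvw
    -- The components are variables so that their equality can be substituted in the dependent
    -- types.
    have key : ∀ (c d : Y.graph.ConnectedComponent) (hc : v ∈ c.supp) (hd : w ∈ d.supp), c = d →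
        (sigmaGraph fun k : Set.range i => (X k).graph).Adj ⟨⟨i c, c, rfl⟩, f c ⟨v, hc⟩⟩
          ⟨⟨i d, d, rfl⟩, f d ⟨w, hd⟩⟩ := by
      rintro c _ hc hd rfl
      exact (sigmaGraph_adj_mk fun k : Set.range i => (X k).graph).2 ((f c).map_adj hvw)
    exact key _ _ rfl rfl (SimpleGraph.ConnectedComponent.connectedComponentMk_eq_of_adj hvw)
  · choose c hc using fun k : Set.range i => k.2
    have hc' : ∀ k : Set.range i, (X k) = X (i (c k)) := fun k => by rw [hc k]
    have hg' : ∀ k : Set.range i, (X k).HomTo (Y.induce (c k).supp) := fun k => by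
      rw [hc' k]
      exact ⟨g _, hg _⟩
    choose g' hg' using hg'
    refine ⟨⟨fun x => (g' x.1 x.2).1, ?_⟩, fun x => hg' x.1 x.2⟩
    rintro ⟨k, x⟩ ⟨l, y⟩ ⟨h, hxy⟩
    dsimp at h
    subst h
    exact (g' k).map_adj hxy

/-- Since labels remember adjacency to the deleted vertex, label preserving maps in both directions
extend over the apex. -/
theorem HomFinite.cone [Finite L] {P : LabeledGraph.{u} (L × Prop) → Prop} (hP : HomFinite P) :
    HomFinite fun Y : LabeledGraph.{u} L => ∃ v, P (Y.deleteVert v) := by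
  classical
  obtain ⟨ι, _, X, hX⟩ := hP
  refine ⟨L × ι, inferInstance, fun k => LabeledGraph.cone k.1 (X k.2), fun Y ⟨v, hv⟩ => ?_⟩
  obtain ⟨i, ⟨f, hf⟩, ⟨g, hg⟩⟩ := hX _ hv
  let F : Y.V → (LabeledGraph.cone (Y.label v) (X i)).V :=
    fun w => if h : w = v then none else some (f ⟨w, h⟩)
  have hF : F v = none := dif_pos rfl
  have hF' : ∀ w (h : w ≠ v), F w = some (f ⟨w, h⟩) := fun w h => dif_neg h
  refine ⟨(Y.label v, i), ⟨⟨F, ?_⟩, ?_⟩, ⟨⟨fun x => Option.elim x v fun x => (g x).1, ?_⟩, ?_⟩⟩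
  · intro x y hxy
    by_cases hx : x = v <;> by_cases hy : y = v
    · subst hx hy
      exact (Y.graph.loopless.irrefl _ hxy).elim
    · subst hx
      rw [hF, hF' y hy]
      exact (congrArg Prod.snd (hf ⟨y, hy⟩)).mpr hxy
    · subst hy
      rw [hF, hF' x hx]
      exact (congrArg Prod.snd (hf ⟨x, hx⟩)).mpr hxy.symm
    · rw [hF' x hx, hF' y hy]
      have hxy : (Y.deleteVert v).graph.Adj ⟨x, hx⟩ ⟨y, hy⟩ := hxy
      exact f.map_adj hxy
  · intro w
    by_cases h : w = v
    · subst h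
      change (LabeledGraph.cone _ _).label (F w) = _
      rw [hF]
      rfl
    · change (LabeledGraph.cone _ _).label (F w) = _
      rw [hF' w h]
      exact congrArg Prod.fst (hf ⟨w, h⟩)
  · rintro (_ | x) (_ | y) h
    · exact h.elim
    · have h : ((X i).label y).2 := h
      rw [← hg] at h
      exact h
    · have h : ((X i).label x).2 := h
      rw [← hg] at h
      exact h.symm
    · exact g.map_adj h
  · rintro (_ | x)
    · rfl
    · have := hg x
      change _ = ((X i).label x).1
      rw [← this]
      rfl

/-- Removing one vertex from each component, `n` times over, exhausts the connected graph. -/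
def TreeDepthLE : ℕ → ∀ {L : Type}, LabeledGraph.{u} L → Prop
  | 0, _, _ => False
  | n + 1, _, Y => ∃ v, ∀ c : (Y.deleteVert v).graph.ConnectedComponent,
      TreeDepthLE n ((Y.deleteVert v).induce c.supp)

theorem homFinite_treeDepthLE (n : ℕ) :
    ∀ (L : Type) [Finite L], HomFinite fun Y : LabeledGraph.{u} L => Y.TreeDepthLE n := by
  induction n with
  | zero => exact fun L _ => ⟨Empty, inferInstance, fun e => e.elim, fun _ h => h.elim⟩
  | succ n ih => exact fun L _ => (ih (L × Prop)).components.cone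

/-- As in depth-first search: after deleting `v`, each component contains a neighbour of `v`, and a
path starting there becomes one vertex longer when `v` is put in front. -/
theorem treeDepthLE_of_forall_path_length_le (n : ℕ) :
    ∀ {L : Type} (Y : LabeledGraph.{u} L) (v : Y.V), Y.graph.Preconnected →
      (∀ l : List Y.V, (v :: l).IsChain Y.graph.Adj → (v :: l).Nodup → (v :: l).length ≤ n) →
      Y.TreeDepthLE n := by
  induction n with
  | zero =>
    intro L Y v _ h
    have := h [] (by simp) (by simp)
    simp at this
  | succ n ih =>
    intro L Y v hY h
    refine ⟨v, fun c => ?_⟩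
    obtain ⟨w, hw⟩ : ∃ w ∈ c.supp, Y.graph.Adj v w.1 := by
      induction c using SimpleGraph.ConnectedComponent.ind with | _ a
      obtain ⟨a, ha⟩ := a
      obtain ⟨p⟩ := hY a v
      induction p with
      | nil => exact (ha rfl).elim
      | @cons a b v hab p ih =>
        by_cases hb : b = v
        · subst hb
          exact ⟨⟨a, ha⟩, rfl, hab.symm⟩
        · obtain ⟨w, hw, hvw⟩ := ih h hb
          refine ⟨w, ?_, hvw⟩
          rw [SimpleGraph.ConnectedComponent.mem_supp_iff] at hw ⊢
          rw [hw]
          apply SimpleGraph.ConnectedComponent.connectedComponentMk_eq_of_adj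
          exact hab.symm
    refine ih _ ⟨w, hw.1⟩ ?_ fun l hl hl' => ?_
    · exact c.connected_toSimpleGraph.preconnected
    · have := h (((⟨w, hw.1⟩ : c.supp) :: l).map fun x => x.1.1) ?_ ?_
      · rw [List.length_cons, List.length_map] at this
        exact Nat.le_of_succ_le_succ this
      · rw [List.isChain_cons]
        refine ⟨?_, ?_⟩
        · intro y hy
          obtain rfl : w.1 = y := Option.some.inj hy
          exact hw.2
        · rw [List.isChain_map]
          exact hl
      · rw [List.nodup_cons]
        refine ⟨?_, hl'.map ?_⟩
        · intro hv
          obtain ⟨x, _, hx⟩ := List.mem_map.1 hv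
          exact x.1.2 hx
        · intro x y hxy
          exact Subtype.ext (Subtype.ext hxy)

/-- Finite labelled graphs without long paths are, up to homomorphic equivalence, finite in
number. -/
theorem homFinite_of_path_length_le (n : ℕ) (L : Type) [Finite L] :
    HomFinite fun Y : LabeledGraph.{u} L =>
      ∀ l : List Y.V, l.IsChain Y.graph.Adj → l.Nodup → l.length ≤ n := by
  obtain ⟨ι, hι, X, hX⟩ := (homFinite_treeDepthLE.{u} n L).components
  refine ⟨ι, hι, X, fun Y hY => hX Y fun c => ?_⟩
  obtain ⟨v, hv⟩ := c.nonempty_supp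
  refine treeDepthLE_of_forall_path_length_le n _ ⟨v, hv⟩
    c.connected_toSimpleGraph.preconnected fun l hl hl' => ?_
  have := hY (((⟨v, hv⟩ : c.supp) :: l).map Subtype.val)
    ((List.isChain_map _).2 hl) (hl'.map Subtype.val_injective)
  rwa [List.length_map] at this

end LabeledGraph

/-! ### Decomposition into unions of geodesics -/

namespace SimpleGraph

variable {V : Type*}

/-- The spanning subgraph formed by the edges inside a set of vertices. -/
def edgesIn (G : SimpleGraph V) (A : Set V) : SimpleGraph V where
  Adj x y := G.Adj x y ∧ x ∈ A ∧ y ∈ A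
  symm := ⟨fun _ _ h => ⟨h.1.symm, h.2.2, h.2.1⟩⟩
  loopless := ⟨fun _ h => G.loopless.irrefl _ h.1⟩

variable {G : SimpleGraph V} {A : Set V}

theorem edgesIn_mono {B : Set V} (h : A ⊆ B) : G.edgesIn A ≤ G.edgesIn B :=
  fun _ _ hxy => ⟨hxy.1, h hxy.2.1, h hxy.2.2⟩

theorem mem_of_reachable_edgesIn {x y : V} (h : (G.edgesIn A).Reachable x y) (hx : x ∈ A) :
    y ∈ A := by
  obtain ⟨p⟩ := h
  induction p with
  | nil => exact hx
  | cons h _ ih => exact ih h.2.2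

theorem reachable_edgesIn_of_connected_induce {B : Set V} (hB : (G.induce B).Connected)
    (hBA : B ⊆ A) {x y : V} (hx : x ∈ B) (hy : y ∈ B) : (G.edgesIn A).Reachable x y :=
  let f : G.induce B →g G.edgesIn A := ⟨Subtype.val, fun {a b} hab => ⟨hab, hBA a.2, hBA b.2⟩⟩
  (hB.preconnected ⟨x, hx⟩ ⟨y, hy⟩).map f

theorem reachable_induce_of_support_subset {B : Set V} {x y : V} (p : (G.edgesIn A).Walk x y)
    (hp : ∀ z ∈ p.support, z ∈ B) (hx : x ∈ B) (hy : y ∈ B) :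
    (G.induce B).Reachable ⟨x, hx⟩ ⟨y, hy⟩ := by
  induction p with
  | nil => rfl
  | @cons a b c hab p ih =>
    have hb : b ∈ B := hp _ (by simp)
    have hab' : (G.induce B).Adj ⟨a, hx⟩ ⟨b, hb⟩ := hab.1
    refine hab'.reachable.trans (ih ?_ hb hy)
    intro z hz
    exact hp _ (by simp [hz])

theorem exists_walk_of_isChain_cons {x y : V} {l : List V} (hl : (x :: l).IsChain G.Adj)
    (hA : ∀ z ∈ x :: l, z ∈ A) (hy : y ∈ x :: l) :
    ∃ p : (G.edgesIn A).Walk x y, p.length ≤ l.length := by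
  induction l generalizing x with
  | nil =>
    obtain rfl : y = x := by simpa using hy
    exact ⟨Walk.nil, le_rfl⟩
  | cons z l ih =>
    by_cases hxy : y = x
    · subst hxy
      exact ⟨Walk.nil, Nat.zero_le _⟩
    · rw [List.isChain_cons_cons] at hl
      obtain ⟨p, hp⟩ := ih hl.2 (fun w hw => hA w (List.mem_cons_of_mem _ hw))
        ((List.mem_cons.1 hy).resolve_left hxy)
      have hxz : (G.edgesIn A).Adj x z := ⟨hl.1, hA _ (by simp), hA _ (by simp)⟩
      exact ⟨Walk.cons hxz p, by simpa using hp⟩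

theorem exists_walk_of_isChain {x y : V} {l : List V} (hl : l.IsChain G.Adj)
    (hA : ∀ z ∈ l, z ∈ A) (hx : x ∈ l) (hy : y ∈ l) :
    ∃ p : (G.edgesIn A).Walk x y, p.length < l.length := by
  induction l with
  | nil => simp at hx
  | cons z l ih =>
    by_cases hxz : x = z
    · subst hxz
      obtain ⟨p, hp⟩ := exists_walk_of_isChain_cons hl hA hy
      exact ⟨p, by simpa using Nat.lt_succ_of_le hp⟩
    · by_cases hyz : y = z
      · subst hyz
        obtain ⟨p, hp⟩ := exists_walk_of_isChain_cons hl hA hx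
        exact ⟨p.reverse, by simpa using Nat.lt_succ_of_le hp⟩
      · obtain ⟨p, hp⟩ := ih (List.isChain_cons.1 hl).2
          (fun w hw => hA w (List.mem_cons_of_mem _ hw))
          ((List.mem_cons.1 hx).resolve_left hxz) ((List.mem_cons.1 hy).resolve_left hyz)
        exact ⟨p, hp.trans (by simp)⟩

theorem eq_getVert_dist_of_mem_support {u v x : V} (p : G.Walk u v) (hp : p.length = G.dist u v)
    (hx : x ∈ p.support) : x = p.getVert (G.dist u x) := by
  classical
  rw [← length_eq_dist_of_subwalk hp (p.isSubwalk_takeUntil hx), Walk.getVert_length_takeUntil]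

/-- `G` has a complete graph on `t` vertices as a minor. -/
def HasCliqueMinor (G : SimpleGraph V) (t : ℕ) : Prop :=
  ∃ B : Fin t → Set V, (∀ i, (G.induce (B i)).Connected) ∧
    (∀ i j, i ≠ j → Disjoint (B i) (B j)) ∧
    (∀ i j, i ≠ j → ∃ x ∈ B i, ∃ y ∈ B j, G.Adj x y)

theorem pos_of_not_hasCliqueMinor {t : ℕ} (ht : ¬ G.HasCliqueMinor t) : 0 < t := by
  rcases Nat.eq_zero_or_pos t with rfl | h0
  · exact (ht ⟨fun i => i.elim0, fun i => i.elim0, fun i => i.elim0, fun i => i.elim0⟩).elim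
  · exact h0

/-- The parts of index less than `idx v` with a neighbour in the component of `v` in the union of
the parts of index at least `idx v`. -/
def attached (G : SimpleGraph V) (idx : V → ℕ) (v : V) : Set ℕ :=
  {b | b < idx v ∧ ∃ w u, (G.edgesIn {x | idx v ≤ idx x}).Reachable v w ∧ G.Adj w u ∧ idx u = b}

theorem finite_attached (idx : V → ℕ) (v : V) : (G.attached idx v).Finite :=
  (Set.finite_Iio (idx v)).subset fun _ hb => hb.1

theorem attached_subset {idx : V → ℕ} {v w : V} (h : idx v = idx w)
    (hvw : (G.edgesIn {x | idx v ≤ idx x}).Reachable v w) :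
    G.attached idx w ⊆ G.attached idx v := by
  rintro b ⟨hb, x, y, hx, hxy⟩
  rw [← h] at hb hx
  exact ⟨hb, x, y, hvw.trans hx, hxy⟩

/-- A partial decomposition of a graph into parts: the part of index `a < n` consists of the
vertices `v` with `idx v = a`, and the vertices with `idx v = n` belong to no part yet. The parts
are connected, the parts attached to a vertex are pairwise adjacent, and two vertices of a part
on which `ψ` agrees have distance at least `R` in the union of this part and the later ones. -/
structure IsDecomposition (G : SimpleGraph V) (t R n : ℕ) (idx : V → ℕ)
    (ψ : V → Fin t × Fin R) : Prop where
  le : ∀ v, idx v ≤ n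
  connected : ∀ a < n, (G.induce {v | idx v = a}).Connected
  clique : ∀ v, ∀ b ∈ G.attached idx v, ∀ c ∈ G.attached idx v, b < c →
    ∃ x y, idx x = b ∧ idx y = c ∧ G.Adj x y
  separated : ∀ v w, idx v = idx w → idx v < n → ψ v = ψ w → v ≠ w →
    ∀ p : (G.edgesIn {x | idx v ≤ idx x}).Walk v w, R ≤ p.length

namespace IsDecomposition

variable {t R n : ℕ} {idx : V → ℕ} {ψ : V → Fin t × Fin R}

/-- Attached parts are connected, disjoint and pairwise adjacent, so `t` of them would be the branch
sets of a clique minor. -/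
theorem ncard_attached_lt (h : G.IsDecomposition t R n idx ψ) (ht : ¬ G.HasCliqueMinor t)
    (v : V) : (G.attached idx v).ncard < t := by
  by_contra! hlt
  have := (finite_attached (G := G) idx v).fintype
  rw [Set.ncard_eq_toFinset_card', Set.toFinset_card] at hlt
  obtain ⟨e⟩ : Nonempty (Fin t ↪ G.attached idx v) :=
    Function.Embedding.nonempty_of_card_le (by simpa using hlt)
  have hne : ∀ i j, i ≠ j → (e i : ℕ) ≠ e j := fun i j hij h => hij (e.injective (Subtype.ext h))
  refine ht ⟨fun i => {x | idx x = e i},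
    fun i => h.connected _ ((e i).2.1.trans_le (h.le v)), fun i j hij => ?_, fun i j hij => ?_⟩
  · rw [Set.disjoint_left]
    intro x hx hx'
    exact hne i j hij (hx.symm.trans hx')
  · rcases (hne i j hij).lt_or_gt with hlt | hlt
    · obtain ⟨x, y, hx, hy, hxy⟩ := h.clique v _ (e i).2 _ (e j).2 hlt
      exact ⟨x, hx, y, hy, hxy⟩
    · obtain ⟨x, y, hx, hy, hxy⟩ := h.clique v _ (e j).2 _ (e i).2 hlt
      exact ⟨y, hy, x, hx, hxy.symm⟩

theorem exists_targets (h : G.IsDecomposition t R n idx ψ) (ht : ¬ G.HasCliqueMinor t) (v : V) :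
    ∃ u : Fin t → V, (∀ j, (G.edgesIn {x | idx v ≤ idx x}).Reachable v (u j)) ∧
      ∀ b ∈ G.attached idx v, ∃ j z, G.Adj (u j) z ∧ idx z = b := by
  have hlt := h.ncard_attached_lt ht v
  have := (finite_attached (G := G) idx v).fintype
  rw [Set.ncard_eq_toFinset_card', Set.toFinset_card] at hlt
  let e := Fintype.equivFin (G.attached idx v)
  choose w z hw hwz hz using fun b : G.attached idx v => b.2.2
  refine ⟨fun j => if hj : j.1 < Fintype.card (G.attached idx v) then w (e.symm ⟨j, hj⟩) else v,
    fun j => ?_, fun b hb => ⟨⟨e ⟨b, hb⟩, (e ⟨b, hb⟩).2.trans hlt⟩, z ⟨b, hb⟩, ?_, hz _⟩⟩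
  · dsimp only
    split_ifs with hj
    · exact hw _
    · rfl
  · have h1 : (e ⟨b, hb⟩).1 < Fintype.card (G.attached idx v) := (e ⟨b, hb⟩).2
    simpa only [h1, dite_true, Fin.eta, Equiv.symm_apply_apply] using hwz ⟨b, hb⟩

/-- The new part joins `v₀` by geodesics to a neighbour of every attached part. It thus touches all
of them, which preserves `clique`. -/
theorem extend (h : G.IsDecomposition t R n idx ψ) (ht : ¬ G.HasCliqueMinor t) (hR : 0 < R)
    {v₀ : V} (hv₀ : idx v₀ = n) :
    ∃ idx' ψ', G.IsDecomposition t R (n + 1) idx' ψ' ∧ {x | idx' x = n + 1} ⊂ {x | idx x = n} := by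
  classical
  have ht0 := pos_of_not_hasCliqueMinor ht
  obtain ⟨u, hu, hu'⟩ := h.exists_targets ht v₀
  rw [hv₀] at hu
  set Gn := G.edgesIn {x | n ≤ idx x} with hGn
  choose P hP using fun j => (hu j).exists_walk_length_eq_dist
  set H : Set V := {x | ∃ j, x ∈ (P j).support} with hH
  have hreach : ∀ x ∈ H, Gn.Reachable v₀ x := fun x ⟨j, hx⟩ => ⟨(P j).takeUntil x hx⟩
  have hv₀H : v₀ ∈ H := ⟨⟨0, ht0⟩, by simp⟩
  have hidxH : ∀ x ∈ H, idx x = n := fun x hx =>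
    le_antisymm (h.le x) (mem_of_reachable_edgesIn (A := {x | n ≤ idx x}) (hreach x hx) hv₀.ge)
  let idx' : V → ℕ := fun x => if x ∈ H then n else if idx x = n then n + 1 else idx x
  let ψ' : V → Fin t × Fin R := fun x =>
    -- A geodesic through `x`, and the position on it modulo `R`.
    if hx : x ∈ H then (hx.choose, ⟨Gn.dist v₀ x % R, Nat.mod_lt _ hR⟩) else ψ x
  have hle : ∀ x, idx' x ≤ n + 1 := fun x => by
    have := h.le x
    simp only [idx']
    split_ifs <;> omega
  have hlt : ∀ {x a}, a < n → (idx' x = a ↔ idx x = a) := fun {x a} ha => by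
    have := hidxH x
    simp only [idx']
    split_ifs with h1 h2
    · have := this h1
      omega
    · omega
    · rfl
  have hn : ∀ {x}, idx' x = n ↔ x ∈ H := fun {x} => by
    simp only [idx']
    split_ifs with h1 h2
    · simp [h1]
    · simp [h1]
    · simp [h1, h2]
  have hn1 : ∀ {x}, idx' x = n + 1 ↔ idx x = n ∧ x ∉ H := fun {x} => by
    have := h.le x
    simp only [idx']
    split_ifs with h1 h2
    · simp [h1]
    · simp [h1, h2]
    · simp [h2]
      omega
  have hge : ∀ {x a}, a ≤ n → (a ≤ idx' x ↔ a ≤ idx x) := fun {x a} ha => by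
    have := hidxH x
    simp only [idx']
    split_ifs with h1 h2
    · have := this h1
      omega
    · omega
    · rfl
  have hset : ∀ a ≤ n, {x | a ≤ idx' x} = {x | a ≤ idx x} := fun a ha => Set.ext fun x => hge ha
  have hcases : ∀ x, (idx' x = idx x ∧ idx' x ≤ n) ∨ idx' x = n + 1 := fun x => by
    rcases (hle x).lt_or_eq with h1 | h1
    · rcases (Nat.lt_succ_iff.1 h1).lt_or_eq with h2 | h2
      · exact Or.inl ⟨((hlt h2).1 rfl).symm, h2.le⟩
      · exact Or.inl ⟨h2.trans (hidxH x (hn.1 h2)).symm, h2.le⟩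
    · exact Or.inr h1
  have hHconn : (G.induce H).Connected := by
    rw [connected_iff_exists_forall_reachable]
    refine ⟨⟨v₀, hv₀H⟩, fun ⟨x, hx⟩ => ?_⟩
    obtain ⟨j, hj⟩ := hx
    refine reachable_induce_of_support_subset ((P j).takeUntil x hj) (fun z hz => ?_) _ _
    exact ⟨j, (P j).support_takeUntil_subset_support hj hz⟩
  refine ⟨idx', ψ', ⟨hle, fun a ha => ?_, fun v b hb c hc hbc => ?_, fun v w hvw hvn hψ hne => ?_⟩,
    ?_⟩
  · rcases (Nat.lt_succ_iff.1 ha).lt_or_eq with h1 | rfl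
    · have : {v | idx' v = a} = {v | idx v = a} := Set.ext fun x => hlt h1
      rw [this]
      exact h.connected a h1
    · have : {v | idx' v = a} = H := Set.ext fun x => hn
      rw [this]
      exact hHconn
  · have hbv := hb.1
    have hcv := hc.1
    rcases hcases v with ⟨hv, hvn⟩ | hv
    · have hatt : ∀ d ∈ G.attached idx' v, d ∈ G.attached idx v := by
        rintro d ⟨hd, x, y, hx, hxy, hy⟩
        rw [hset _ hvn, hv] at hx
        exact ⟨hv ▸ hd, x, y, hx, hxy, (hlt (hd.trans_le hvn)).1 hy⟩
      obtain ⟨x, y, hx, hy, hxy⟩ := h.clique v b (hatt b hb) c (hatt c hc) hbc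
      exact ⟨x, y, (hlt (by omega)).2 hx, (hlt (by omega)).2 hy, hxy⟩
    · have hvn := hn1.1 hv
      have hsub : {x | idx' v ≤ idx' x} ⊆ {x | n ≤ idx x} := fun x hx =>
        (hn1.1 (le_antisymm (hle x) (hv ▸ hx))).1.ge
      have hatt : ∀ d ∈ G.attached idx' v, d < n → d ∈ G.attached idx v := by
        rintro d ⟨hd, x, y, hx, hxy, hy⟩ hdn
        refine ⟨hvn.1.symm ▸ hdn, x, y, ?_, hxy, (hlt hdn).1 hy⟩
        rw [hvn.1]
        exact hx.mono (edgesIn_mono hsub)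
      rcases (show c ≤ n by omega).lt_or_eq with hcn | rfl
      · obtain ⟨x, y, hx, hy, hxy⟩ :=
          h.clique v b (hatt b hb (hbc.trans hcn)) c (hatt c hc hcn) hbc
        exact ⟨x, y, (hlt (by omega)).2 hx, (hlt (by omega)).2 hy, hxy⟩
      -- Here `c` is the new part, so `v` was in the component of `v₀`; the part `b` is then
      -- attached to `v₀` as well and meets the end of one of the geodesics.
      · obtain ⟨-, x, y, hx, hxy, hy⟩ := hc
        have hyH := hn.1 hy
        have hx' : Gn.Reachable v x := hx.mono (edgesIn_mono hsub)
        have hxy' : Gn.Adj x y := ⟨hxy, mem_of_reachable_edgesIn hx' hvn.1.ge, (hidxH y hyH).ge⟩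
        have hv₀v : Gn.Reachable v₀ v :=
          (hreach y hyH).trans (hx'.trans hxy'.reachable).symm
        have hb' : b ∈ G.attached idx v₀ :=
          attached_subset (hv₀.trans hvn.1.symm) (by rwa [hv₀]) (hatt b hb hbc)
        obtain ⟨j, z, hjz, hz⟩ := hu' b hb'
        exact ⟨z, u j, (hlt hbc).2 hz, hn.2 ⟨j, by simp⟩, hjz.symm⟩
  · have hvn' := Nat.lt_succ_iff.1 hvn
    rw [hset _ hvn']
    rcases hvn'.lt_or_eq with h1 | h1
    · have hv : idx v = idx' v := (hlt h1).1 rfl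
      have hw : idx w = idx' v := (hlt h1).1 hvw.symm
      have hvH : v ∉ H := fun hH => h1.ne (hn.2 hH)
      have hwH : w ∉ H := fun hH => h1.ne (hvw.trans (hn.2 hH))
      simp only [ψ', hvH, hwH, dite_false] at hψ
      rw [← hv]
      exact h.separated v w (hv.trans hw.symm) (hv ▸ h1) hψ hne
    · rw [h1]
      intro p
      have hvH : v ∈ H := hn.1 h1
      have hwH : w ∈ H := hn.1 (hvw.symm.trans h1)
      simp only [ψ', hvH, hwH, dite_true, Prod.mk.injEq, Fin.mk.injEq] at hψ
      by_contra! hp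
      -- The distances agree modulo `R` and differ by less than `R`.
      have hd : Gn.dist v₀ v = Gn.dist v₀ w := by
        have h2 : Gn.dist v w ≤ p.length := dist_le p
        have h3 := (hreach v hvH).dist_triangle_left w
        have h4 := (hreach w hwH).dist_triangle_left v
        rw [dist_comm (u := w)] at h4
        refine Nat.ModEq.eq_of_abs_lt hψ.2 ?_
        rw [abs_lt]
        omega
      have h5 := eq_getVert_dist_of_mem_support _ (hP _) hvH.choose_spec
      have h6 := eq_getVert_dist_of_mem_support _ (hP _) hwH.choose_spec
      have h7 : ∀ i j, i = j → (P i).getVert (Gn.dist v₀ v) = (P j).getVert (Gn.dist v₀ w) := by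
        rintro i _ rfl
        rw [hd]
      exact hne (h5.trans ((h7 _ _ hψ.1).trans h6.symm))
  · refine ⟨fun x hx => (hn1.1 hx).1, fun hsub => ?_⟩
    exact (hn1.1 (hsub hv₀)).2 hv₀H

end IsDecomposition

theorem exists_isDecomposition [Finite V] {t R : ℕ} (ht : ¬ G.HasCliqueMinor t) (hR : 0 < R) :
    ∃ n idx ψ, G.IsDecomposition t R n idx ψ ∧ ∀ v, idx v < n := by
  have ht0 := pos_of_not_hasCliqueMinor ht
  have key : ∀ k n idx ψ, G.IsDecomposition t R n idx ψ → {x | idx x = n}.ncard ≤ k →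
      ∃ n idx ψ, G.IsDecomposition t R n idx ψ ∧ ∀ v, idx v < n := by
    intro k
    induction k with
    | zero =>
      intro n idx ψ h hk
      refine ⟨n, idx, ψ, h, fun v => (h.le v).lt_of_ne fun hv => ?_⟩
      rw [Nat.le_zero, Set.ncard_eq_zero] at hk
      exact hk.le hv
    | succ k ih =>
      intro n idx ψ h hk
      by_cases hv : ∀ v, idx v < n
      · exact ⟨n, idx, ψ, h, hv⟩
      · push Not at hv
        obtain ⟨v, hv⟩ := hv
        obtain ⟨idx', ψ', h', hlt⟩ := h.extend ht hR (le_antisymm (h.le v) hv)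
        exact ih _ _ _ h' (Nat.lt_succ_iff.1 ((Set.ncard_lt_ncard hlt).trans_le hk))
  refine key _ 0 (fun _ => 0) (fun _ => (⟨0, ht0⟩, ⟨0, hR⟩)) ⟨fun _ => le_rfl, ?_, ?_, ?_⟩ le_rfl
  · intro a ha
    omega
  · intro v b hb
    exact absurd hb.1 (Nat.not_lt_zero _)
  · intro v w _ hv
    exact absurd hv (Nat.not_lt_zero _)

end SimpleGraph

/-! ### Greedy colouring and bounded backward reachability -/

theorem exists_coloring_of_back_degree_le {N : ℕ} (q : ℕ → Finset ℕ) (hq : ∀ a, ∀ b ∈ q a, b < a)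
    (hN : ∀ a, (q a).card ≤ N) : ∃ κ : ℕ → Fin (N + 1), ∀ a, ∀ b ∈ q a, κ b ≠ κ a := by
  classical
  have hpick : ∀ s : Finset (Fin (N + 1)), s.card ≤ N → ∃ x, x ∉ s := fun s hs => by
    by_contra! h
    have := Finset.card_le_card fun x (_ : x ∈ Finset.univ) => h x
    rw [Finset.card_univ, Fintype.card_fin] at this
    omega
  choose pick hpick using hpick
  have hcard : ∀ a (f : ∀ b, b < a → Fin (N + 1)),
      ((q a).attach.image fun b => f b.1 (hq a b.1 b.2)).card ≤ N := fun a f =>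
    Finset.card_image_le.trans (by simpa using hN a)
  let κ : ℕ → Fin (N + 1) := WellFounded.fix wellFounded_lt fun a f => pick _ (hcard a f)
  refine ⟨κ, fun a b hb h => ?_⟩
  have h1 : κ a = pick _ (hcard a fun b _ => κ b) := WellFounded.fix_eq _ _ _
  refine hpick _ (hcard a fun b _ => κ b) ?_
  rw [← h1, ← h]
  exact Finset.mem_image.2 ⟨⟨b, hb⟩, Finset.mem_attach _ _, rfl⟩

/-- The elements reached from `a` in at most `k` steps, where `p b` is one step from `b`. -/
def stepsFrom (p : ℕ → Finset ℕ) : ℕ → ℕ → Finset ℕ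
  | 0, a => {a}
  | k + 1, a => insert a ((p a).biUnion (stepsFrom p k))

theorem stepsFrom_subset_succ (p : ℕ → Finset ℕ) (k a : ℕ) :
    stepsFrom p k a ⊆ stepsFrom p (k + 1) a := by
  induction k generalizing a with
  | zero => simp [stepsFrom]
  | succ k ih =>
    exact Finset.insert_subset_insert _ (Finset.biUnion_mono fun b _ => ih b)

theorem stepsFrom_mono (p : ℕ → Finset ℕ) (a : ℕ) : Monotone fun k => stepsFrom p k a :=
  monotone_nat_of_le_succ fun k => stepsFrom_subset_succ p k a

theorem le_of_mem_stepsFrom {p : ℕ → Finset ℕ} (hp : ∀ a, ∀ b ∈ p a, b < a) {k a b : ℕ}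
    (hb : b ∈ stepsFrom p k a) : b ≤ a := by
  induction k generalizing a with
  | zero => exact (Finset.mem_singleton.1 hb).le
  | succ k ih =>
    rcases Finset.mem_insert.1 hb with rfl | hb
    · exact le_rfl
    · obtain ⟨c, hc, hbc⟩ := Finset.mem_biUnion.1 hb
      exact (ih hbc).trans (hp a c hc).le

theorem exists_card_stepsFrom_le (t k : ℕ) : ∃ N, ∀ p : ℕ → Finset ℕ, (∀ a, (p a).card ≤ t) →
    ∀ a, (stepsFrom p k a).card ≤ N := by
  induction k with
  | zero => exact ⟨1, fun p _ a => by simp [stepsFrom]⟩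
  | succ k ih =>
    obtain ⟨N, hN⟩ := ih
    refine ⟨t * N + 1, fun p hp a => (Finset.card_insert_le _ _).trans ?_⟩
    exact Nat.succ_le_succ ((Finset.card_biUnion_le_card_mul _ _ N fun b _ => hN p hp b).trans
      (Nat.mul_le_mul_right _ (hp a)))

/-! ### Colourings with a uniquely coloured vertex on short paths -/

namespace SimpleGraph

variable {V : Type*} {G : SimpleGraph V}

/-- While the walk stays in parts of index at least `idx w`, it remains in the component of `w`.
When it first drops below, it enters an attached part: one backward step, after which `w` is
replaced by the current vertex. -/
theorem mem_stepsFrom_of_walk {idx : V → ℕ} {p : ℕ → Finset ℕ}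
    (hp : ∀ v, ∀ b ∈ G.attached idx v, b ∈ p (idx v)) {x v : V} (q : G.Walk x v)
    (hq : ∀ z ∈ q.support, idx v ≤ idx z) {w : V}
    (hwx : (G.edgesIn {z | idx w ≤ idx z}).Reachable w x) (hvw : idx v ≤ idx w) :
    idx v ∈ stepsFrom p q.length (idx w) := by
  induction q generalizing w with
  | @nil x =>
    have : idx w ≤ idx x :=
      mem_of_reachable_edgesIn (A := {z | idx w ≤ idx z}) hwx (le_refl (idx w))
    simp [stepsFrom, le_antisymm this hvw]
  | @cons x y v hxy q ih =>
    have hq' : ∀ z ∈ q.support, idx v ≤ idx z := fun z hz => hq z (by simp [hz])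
    rw [Walk.length_cons]
    rcases le_or_gt (idx w) (idx y) with hy | hy
    · refine stepsFrom_subset_succ _ _ _ (ih hq' (hwx.trans ?_) hvw)
      have hxy' : (G.edgesIn {z | idx w ≤ idx z}).Adj x y :=
        ⟨hxy, mem_of_reachable_edgesIn hwx (le_refl (idx w)), hy⟩
      exact hxy'.reachable
    · exact Finset.mem_insert_of_mem (Finset.mem_biUnion.2
        ⟨idx y, hp w _ ⟨hy, x, y, hwx, hxy, rfl⟩, ih hq' (Reachable.refl y) (hq' y (by simp))⟩)

theorem mem_of_mem_support_edgesIn {A : Set V} {x y : V} (q : (G.edgesIn A).Walk x y) (hx : x ∈ A) :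
    ∀ z ∈ q.support, z ∈ A := by
  classical
  exact fun z hz => mem_of_reachable_edgesIn (q.takeUntil z hz).reachable hx

/-- Graphs without a complete minor on `t` vertices have colourings with a bounded number of
colours for which every path with at most `R` vertices has a uniquely coloured vertex. -/
theorem exists_coloring_of_not_hasCliqueMinor (t R : ℕ) : ∃ N, ∀ (V : Type u) [Finite V]
    (G : SimpleGraph V), ¬ G.HasCliqueMinor t → ∃ c : V → Fin N,
      ∀ l : List V, l.IsChain G.Adj → l ≠ [] → l.length ≤ R →
        ∃ v ∈ l, ∀ w ∈ l, c w = c v → w = v := by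
  classical
  obtain ⟨M, hM⟩ := exists_card_stepsFrom_le t R
  refine ⟨Fintype.card (Fin (M + 1) × Fin t × Fin (R + 1)), fun V _ G hG => ?_⟩
  obtain ⟨n, idx, ψ, h, hn⟩ := exists_isDecomposition hG R.succ_pos
  have hatt : ∀ v w, idx v = idx w → G.attached idx w ⊆ G.attached idx v := fun v w hvw =>
    attached_subset hvw (reachable_edgesIn_of_connected_induce (h.connected _ (hn v))
      (fun x (hx : idx x = idx v) => hx.ge) rfl hvw.symm)
  have hP : ∀ a, ∃ s : Finset ℕ, s.card ≤ t ∧ (∀ b ∈ s, b < a) ∧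
      ∀ v, idx v = a → ∀ b ∈ G.attached idx v, b ∈ s := fun a => by
    by_cases ha : ∃ v, idx v = a
    · obtain ⟨v, rfl⟩ := ha
      refine ⟨(finite_attached (G := G) idx v).toFinset, ?_, fun b hb => ?_, fun w hw b hb => ?_⟩
      · rw [← Set.ncard_eq_toFinset_card _ (finite_attached idx v)]
        exact (h.ncard_attached_lt hG v).le
      · exact ((finite_attached (G := G) idx v).mem_toFinset.1 hb).1
      · exact (finite_attached (G := G) idx v).mem_toFinset.2 (hatt v w hw.symm hb)
    · exact ⟨∅, by simp, by simp, fun v hv => (ha ⟨v, hv⟩).elim⟩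
  choose p hpc hplt hp using hP
  obtain ⟨κ, hκ⟩ := exists_coloring_of_back_degree_le (N := M)
    (fun a => (stepsFrom p R a).erase a)
    (fun a b hb => (le_of_mem_stepsFrom hplt (Finset.mem_of_mem_erase hb)).lt_of_ne
      (Finset.ne_of_mem_erase hb))
    (fun a => (Finset.card_le_card (Finset.erase_subset _ _)).trans (hM p hpc a))
  refine ⟨fun v => Fintype.equivFin _ (κ (idx v), ψ v), fun l hl hl0 hlR => ?_⟩
  -- A vertex in the earliest part met by the path is unique: `ψ` excludes rivals in the same part,
  -- `κ` those in later parts.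
  obtain ⟨v, hv, hmin⟩ := l.toFinset.exists_min_image idx (by simpa using hl0)
  rw [List.mem_toFinset] at hv
  have hmin' : ∀ z ∈ l, z ∈ {x | idx v ≤ idx x} := fun z hz => hmin z (List.mem_toFinset.2 hz)
  refine ⟨v, hv, fun w hw hc => ?_⟩
  have hc := (Fintype.equivFin _).injective hc
  simp only [Prod.mk.injEq] at hc
  by_contra hne
  obtain ⟨q, hq⟩ := exists_walk_of_isChain hl hmin' hw hv
  have hwv : idx v ≤ idx w := hmin' w hw
  rcases hwv.eq_or_lt with heq | hlt
  · have h1 : {x | idx v ≤ idx x} = {x | idx w ≤ idx x} := by rw [heq]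
    have := h.separated v w heq (hn v) hc.2.symm (Ne.symm hne) q.reverse
    rw [Walk.length_reverse] at this
    omega
  · have hle : G.edgesIn {x | idx v ≤ idx x} ≤ G := fun _ _ h => h.1
    have h1 := mem_stepsFrom_of_walk (p := p) (fun v => hp _ v rfl) (q.mapLe hle)
      (fun z hz => mem_of_mem_support_edgesIn q hwv z (by simpa using hz)) (Reachable.refl w) hwv
    refine hκ (idx w) (idx v) (Finset.mem_erase.2 ⟨hlt.ne, stepsFrom_mono p _ ?_ h1⟩) hc.1.symm
    simp only [Walk.length_map]
    omega

/-- If every path with at most `2 ^ k` vertices has a uniquely coloured vertex, then paths with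
at least `2 ^ k` vertices have more than `k` colours. -/
theorem lt_card_image_of_two_pow_le_length {C : Type*} [DecidableEq C] {c : V → C} {R : ℕ}
    (hc : ∀ l : List V, l.IsChain G.Adj → l ≠ [] → l.length ≤ R →
      ∃ v ∈ l, ∀ w ∈ l, c w = c v → w = v) (k : ℕ) (hk : 2 ^ k ≤ R) (l : List V)
    (hl : l.IsChain G.Adj) (hl' : l.Nodup) (hlen : 2 ^ k ≤ l.length) :
    k < (l.map c).toFinset.card := by
  induction k generalizing l with
  | zero =>
    rw [Finset.card_pos]
    simp only [List.toFinset_nonempty_iff, ne_eq, List.map_eq_nil_iff]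
    rintro rfl
    simp at hlen
  | succ k ih =>
    have hpos := Nat.two_pow_pos k
    rw [pow_succ] at hk hlen
    -- Truncation makes `hc` applicable. Removing the unique vertex leaves a side with at least `2 ^
    -- k` vertices that avoids its colour.
    set l₀ := l.take (2 ^ k * 2) with hl₀
    have hlen₀ : l₀.length = 2 ^ k * 2 := by rw [hl₀, List.length_take]; omega
    have hchain : l₀.IsChain G.Adj := hl.take _
    have hnodup : l₀.Nodup := hl'.sublist (List.take_sublist _ _)
    obtain ⟨v, hv, huniq⟩ := hc l₀ hchain (by rintro h; rw [h] at hlen₀; simp at hlen₀)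
      (by omega)
    obtain ⟨a, b, hab⟩ := List.append_of_mem hv
    obtain ⟨d, hd, hsub, hvd, hdlen⟩ : ∃ d : List V, d.IsChain G.Adj ∧ d.Sublist l₀ ∧ v ∉ d ∧
        2 ^ k ≤ d.length := by
      rw [hab, List.length_append, List.length_cons] at hlen₀
      rw [hab] at hchain hnodup
      rcases le_or_gt (2 ^ k) a.length with h | h
      · refine ⟨a, hchain.left_of_append, by rw [hab]; exact List.sublist_append_left _ _, ?_, h⟩
        intro hva
        exact (List.nodup_append.1 hnodup).2.2 v hva v (by simp) rfl
      · refine ⟨b, hchain.right_of_append.of_cons, ?_, ?_, by omega⟩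
        · rw [hab]
          exact (List.sublist_cons_self _ _).trans (List.sublist_append_right _ _)
        · exact (List.nodup_cons.1 (List.nodup_append.1 hnodup).2.1).1
    have h1 := ih (by omega) d hd (hnodup.sublist hsub) hdlen
    have h2 : c v ∉ (d.map c).toFinset := by
      simp only [List.mem_toFinset, List.mem_map, not_exists, not_and]
      intro w hw hwv
      exact hvd (huniq w (hsub.subset hw) hwv ▸ hw)
    refine Nat.lt_of_lt_of_le (Nat.succ_lt_succ h1) ?_
    rw [← Nat.add_one, ← Finset.card_insert_of_notMem h2]
    refine Finset.card_le_card (Finset.insert_subset ?_ fun x hx => ?_)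
    · exact List.mem_toFinset.2 (List.mem_map_of_mem (List.mem_of_mem_take hv))
    · obtain ⟨w, hw, rfl⟩ := List.mem_map.1 (List.mem_toFinset.1 hx)
      exact List.mem_toFinset.2 (List.mem_map_of_mem (List.mem_of_mem_take (hsub.subset hw)))

end SimpleGraph

/-! ### Clique minors, Hadwiger numbers and the bound -/

namespace FinGraph

theorem isMinor_of_injective {H G : FinGraph.{u}} (f : H.graph →g G.graph)
    (hf : Function.Injective f) : H.IsMinor G := by
  refine ⟨fun v => {f v}, fun v => ?_, fun v w hvw => ?_, fun v w hvw => ?_⟩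
  · exact SimpleGraph.Connected.of_subsingleton
  · simpa using hf.ne hvw
  · exact ⟨f v, rfl, f w, rfl, f.map_adj hvw⟩

theorem complete_isMinor_complete {m n : ℕ} (h : m ≤ n) :
    (complete.{u} m).IsMinor (complete.{u} n) := by
  have hinj : Function.Injective fun x : (complete.{u} m).V =>
      (ULift.up (Fin.castLE h x.down) : (complete.{u} n).V) := fun x y hxy =>
    ULift.down_injective (Fin.castLE_injective h (ULift.up_injective hxy))
  exact isMinor_of_injective ⟨_, fun {a b} (hab : a ≠ b) => hinj.ne hab⟩ hinj

theorem isMinor_complete (H : FinGraph.{u}) : H.IsMinor (complete.{u} (Nat.card H.V)) := by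
  have := H.finite
  have hinj : Function.Injective fun x : H.V =>
      (ULift.up (Finite.equivFin H.V x) : (complete.{u} (Nat.card H.V)).V) :=
    ULift.up_injective.comp (Finite.equivFin H.V).injective
  exact isMinor_of_injective ⟨_, fun {a b} hab => hinj.ne hab.ne⟩ hinj

theorem complete_isMinor_of_hasCliqueMinor {G : FinGraph.{u}} {t : ℕ}
    (h : G.graph.HasCliqueMinor t) : (complete.{u} t).IsMinor G := by
  obtain ⟨B, h1, h2, h3⟩ := h
  exact ⟨fun v => B v.down, fun v => h1 _,
    fun v w hvw => h2 _ _ fun h => hvw (ULift.down_injective h),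
    fun v w (hvw : v ≠ w) => h3 _ _ fun h => hvw (ULift.down_injective h)⟩

theorem IsProperMinorClosed.exists_complete_notMem {K : Set FinGraph.{u}}
    (hK : IsProperMinorClosed K) : ∃ n, complete.{u} n ∉ K := by
  obtain ⟨H, hH⟩ := (Set.ne_univ_iff_exists_notMem K).1 hK.2
  exact ⟨Nat.card H.V, fun h => hH (hK.1 _ h _ H.isMinor_complete)⟩

theorem IsProperMinorClosed.exists_classHadwigerNumber_eq {K : Set FinGraph.{u}}
    (hK : IsProperMinorClosed K) : ∃ h : ℕ, classHadwigerNumber K = (h : ℕ∞) ∧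
      complete.{u} (h + 1) ∉ K := by
  obtain ⟨n, hn⟩ := hK.exists_complete_notMem
  have hle : classHadwigerNumber K ≤ (n : ℕ∞) := by
    refine iSup₂_le fun G hG => iSup₂_le fun m hm => ?_
    by_contra! hlt
    exact hn (hK.1 _ (hK.1 G hG _ hm) _ (complete_isMinor_complete (by exact_mod_cast hlt.le)))
  obtain ⟨h, hh⟩ := ENat.ne_top_iff_exists.1 (ne_top_of_le_ne_top (ENat.natCast_ne_top n) hle)
  refine ⟨h, hh.symm, fun hmem => ?_⟩
  have h1 : ((h + 1 : ℕ) : ℕ∞) ≤ classHadwigerNumber K :=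
    (le_iSup₂_of_le (h + 1) (complete_isMinor_complete le_rfl) le_rfl :
      _ ≤ hadwigerNumber _).trans (le_iSup₂_of_le _ hmem le_rfl)
  rw [← hh] at h1
  exact absurd (by exact_mod_cast h1) (Nat.not_succ_le_self h)

/-- From graphs `X I`, one for each set of at most `p` colours, the graph whose vertices consist
of a colour and a vertex of each `X I` for which `I` contains the colour. -/
def colorProduct {N p : ℕ} (X : {I : Finset (Fin N) // I.card ≤ p} → LabeledGraph.{u} Unit) :
    SimpleGraph (Σ c : Fin N, ∀ I : {I : Finset (Fin N) // I.card ≤ p}, c ∈ I.1 → (X I).V) where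
  Adj a b := a.1 ≠ b.1 ∧ ∀ I ha hb, (X I).graph.Adj (a.2 I ha) (b.2 I hb)
  symm := ⟨fun _ _ h => ⟨h.1.symm, fun I ha hb => (h.2 I hb ha).symm⟩⟩
  loopless := ⟨fun _ h => h.1 rfl⟩

/-- Take for `I` the set of colours in the image: coordinate `I` is then defined at every image
vertex. -/
theorem exists_hom_of_hom_colorProduct {N p : ℕ}
    (X : {I : Finset (Fin N) // I.card ≤ p} → LabeledGraph.{u} Unit) {V : Type*} [Finite V]
    (hV : Nat.card V ≤ p) {A : SimpleGraph V} (f : A →g colorProduct X) :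
    ∃ I, Nonempty (A →g (X I).graph) := by
  classical
  have := Fintype.ofFinite V
  let I : {I : Finset (Fin N) // I.card ≤ p} := ⟨Finset.univ.image fun v => (f v).1,
    Finset.card_image_le.trans (by rwa [Finset.card_univ, ← Nat.card_eq_fintype_card])⟩
  have hI : ∀ v, (f v).1 ∈ I.1 := fun v => Finset.mem_image_of_mem _ (Finset.mem_univ v)
  exact ⟨I, ⟨⟨fun v => (f v).2 I (hI v), fun {a b} hab => (f.map_adj hab).2 I _ _⟩⟩⟩

theorem exists_bound {K : Set FinGraph.{u}} (hK : IsProperMinorClosed K) (F : Set FinGraph.{u})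
    (hF : F.Finite) (hconn : ∀ A ∈ F, A.graph.Connected) :
    ∃ U ∈ Forb F, ∀ G ∈ K ∩ Forb F, G.HomTo U := by
  classical
  obtain ⟨t, ht⟩ := hK.exists_complete_notMem
  obtain ⟨p, hp1, hp⟩ : ∃ p, 1 ≤ p ∧ ∀ A ∈ F, Nat.card A.V ≤ p := by
    obtain ⟨p, hp⟩ := (hF.image fun A => Nat.card A.V).bddAbove
    -- The added 1 gives `2 ≤ 2 ^ p`, so edges count as short paths and the colouring is proper.
    exact ⟨p + 1, by omega, fun A hA => (hp (Set.mem_image_of_mem _ hA)).trans p.le_succ⟩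
  obtain ⟨N, hN⟩ := SimpleGraph.exists_coloring_of_not_hasCliqueMinor.{u} t (2 ^ p)
  obtain ⟨ι, _, X, hX⟩ := LabeledGraph.homFinite_of_path_length_le.{u} (2 ^ p) Unit
  let J := {i : {I : Finset (Fin N) // I.card ≤ p} → ι //
    ∀ I, ∀ A ∈ F, IsEmpty (A.graph →g (X (i I)).graph)}
  let W : J → Type u := fun i =>
    Σ c : Fin N, ∀ I : {I : Finset (Fin N) // I.card ≤ p}, c ∈ I.1 → (X (i.1 I)).V
  have hW : ∀ i, Finite (W i) := fun i =>
    have := fun I => (X (i.1 I)).finite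
    inferInstance
  let H : ∀ i : J, SimpleGraph (W i) := fun i => colorProduct fun I => X (i.1 I)
  refine ⟨⟨Σ i, W i, sigmaGraph H⟩, fun A hA ⟨f⟩ => ?_, fun G hG => ?_⟩
  · obtain ⟨i, ⟨g⟩⟩ := exists_hom_of_hom_sigmaGraph (hconn A hA) H f
    have := A.finite
    obtain ⟨I, ⟨k⟩⟩ := exists_hom_of_hom_colorProduct _ (hp A hA) g
    exact (i.2 I A hA).false k
  · have := G.finite
    obtain ⟨c, hc⟩ := hN G.V G.graph fun h =>
      ht (hK.1 G hG.1 _ (complete_isMinor_of_hasCliqueMinor h))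
    have hproper : ∀ v w, G.graph.Adj v w → c v ≠ c w := fun v w hvw hcvw => by
      obtain ⟨x, hx, huniq⟩ := hc [v, w] (by simpa using hvw) (by simp)
        (by simpa using Nat.pow_le_pow_right two_pos hp1)
      have hcx : c v = c x := by
        rcases List.mem_pair.1 hx with rfl | rfl
        · rfl
        · exact hcvw
      exact hvw.ne ((huniq v (by simp) hcx).trans (huniq w (by simp) (hcvw ▸ hcx)).symm)
    let Y : {I : Finset (Fin N) // I.card ≤ p} → LabeledGraph.{u} Unit := fun I =>
      { V := {v : G.V // c v ∈ I.1}
        graph := G.graph.induce {v | c v ∈ I.1}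
        label := fun _ => () }
    have hY : ∀ I, ∃ i, (Y I).HomTo (X i) ∧ (X i).HomTo (Y I) := fun I =>
        hX (Y I) fun l hl hl' => by
      by_contra! hlt
      have h1 := SimpleGraph.lt_card_image_of_two_pow_le_length hc p le_rfl (l.map Subtype.val)
        ((List.isChain_map _).2 hl) (hl'.map Subtype.val_injective)
        (by rw [List.length_map]; exact hlt.le)
      refine absurd ((Finset.card_le_card fun x hx => ?_).trans I.2) h1.not_ge
      obtain ⟨v, hv, rfl⟩ := List.mem_map.1 (List.mem_toFinset.1 hx)
      obtain ⟨w, _, rfl⟩ := List.mem_map.1 hv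
      exact w.2
    choose i hi hi' using hY
    choose f hf using hi
    -- The selection is admissible because each representative maps back to `Y I`, hence to `G`.
    let j : J := ⟨i, fun I A hA => ⟨fun k => hG.2 A hA ?_⟩⟩
    · refine ⟨⟨fun v => ⟨j, c v, fun I hv => f I ⟨v, hv⟩⟩, fun {v w} hvw => ?_⟩⟩
      refine (sigmaGraph_adj_mk H).2 ⟨hproper v w hvw, fun I hv hw => ?_⟩
      have hvw' : (Y I).graph.Adj ⟨v, hv⟩ ⟨w, hw⟩ := hvw
      exact (f I).map_adj hvw'
    · obtain ⟨g, _⟩ := hi' I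
      let e : (Y I).graph →g G.graph := ⟨Subtype.val, fun {a b} hab => hab⟩
      exact ⟨e.comp (g.comp k)⟩

end FinGraph

theorem mainTheorem7 (K : Set FinGraph.{u}) (hK : FinGraph.IsProperMinorClosed K) :
    (∀ F : Set FinGraph.{u}, F.Finite → (∀ A ∈ F, A.graph.Connected) →
      ∃ U ∈ FinGraph.Forb F, ∀ G ∈ K ∩ FinGraph.Forb F, G.HomTo U) ∧
    (∃ h : ℕ, FinGraph.classHadwigerNumber K = (h : ℕ∞) ∧
      FinGraph.complete.{u} (h + 1) ∉ K ∧
      ∃ U : FinGraph.{u}, U.graph.CliqueFree (h + 1) ∧ ∀ G ∈ K, G.HomTo U) := by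
  refine ⟨FinGraph.exists_bound hK, ?_⟩
  obtain ⟨h, hh, hmem⟩ := hK.exists_classHadwigerNumber_eq
  refine ⟨h, hh, hmem, ?_⟩
  obtain ⟨U, hU, hGU⟩ := FinGraph.exists_bound hK {FinGraph.complete.{u} (h + 1)}
    (Set.finite_singleton _) (by
      rintro A rfl
      have : Nonempty (FinGraph.complete.{u} (h + 1)).V := ⟨⟨0⟩⟩
      exact SimpleGraph.connected_top)
  refine ⟨U, ?_, fun G hG => hGU G ⟨hG, ?_⟩⟩
  · rw [SimpleGraph.cliqueFree_iff]
    refine ⟨fun f => hU _ rfl ⟨⟨fun x => f x.down, fun {a b} (hab : a ≠ b) => ?_⟩⟩⟩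
    exact f.toHom.map_adj fun h => hab (ULift.down_injective h)
  -- A homomorphism from a complete graph is injective, so it would yield a `K_(h+1)` minor.
  · rintro A rfl ⟨f⟩
    refine hmem (hK.1 G hG _ (FinGraph.isMinor_of_injective f fun a b hab => ?_))
    by_contra hne
    have hadj : (FinGraph.complete.{u} (h + 1)).graph.Adj a b := hne
    exact (f.map_adj hadj).ne hab
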